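/- A symmetric collection (of sets) is a contravariant functor $\mathcal{X}$ from the groupoid of finite sets and bijections to sets, and all operads are symmetric operads in sets, with composition $\gamma$. Write $\mathcal{T}(\mathcal{X})$ for the free operad generated by a symmetric collection $\mathcal{X}$, and, for a family $\mathcal{R}$ of pairs of elements of $\mathcal{T}(\mathcal{X})$ with the same inputs, write $\mathcal{T}(\mathcal{X})/(\mathcal{R})$ for its quotient by the smallest operadic congruence containing $\mathcal{R}$. Operations $p$ and $q$ of arities $k$ and $l$ in an operad are said to \emph{interchange} if $$\gamma(p;q,\ldots,q)=\gamma(q;p,\ldots,p).\sigma_{k,l},\qquad \sigma_{k,l}((i-1)l+j)=(j-1)k+i\quad(1\le i\le k,\ 1\le j\le l).$$ The Boardman--Vogt tensor product $\mathcal{P}\otimes\mathcal{Q}$ is the quotient of the coproduct $\mathcal{P}\sqcup\mathcal{Q}$ of operads by the congruence generated by the relations $\gamma(p;q,\ldots,q)=\gamma(q;p,\ldots,p).\sigma_{k,l}$ for all $p\in\mathcal{P}(k)$ and all $q\in\mathcal{Q}(l)$. \textbf{Proposition.} Let $\mathcal{P}\cong\mathcal{T}(\mathcal{X})/(\mathcal{R})$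 and $\mathcal{Q}\cong\mathcal{T}(\mathcal{Y})/(\mathcal{S})$ be presentations of operads by generators and relations. (1) There is an isomorphism of operads $$\mathcal{P}\otimes\mathcal{Q}\;\cong\;\mathcal{T}(\mathcal{X}\sqcup\mathcal{Y})/(\mathcal{R}\sqcup\mathcal{S}\sqcup\mathcal{IC}),$$ where $\mathcal{IC}$ consists of the relations $\gamma(x;y,\ldots,y)=\gamma(y;x,\ldots,x).\sigma_{k,l}$ for all generators $x\in\mathcal{X}(k)$ and $y\in\mathcal{Y}(l)$. It is compatible with the presentations: the image in $\mathcal{P}\otimes\mathcal{Q}$ of the class in $\mathcal{P}$ of $t\in\mathcal{T}(\mathcal{X})$ corresponds to the class of $t$ regarded as an element of $\mathcal{T}(\mathcal{X}\sqcup\mathcal{Y})$, and likewise for $\mathcal{Q}$ and $t\in\mathcal{T}(\mathcal{Y})$. (2) Let $f\colon\mathcal{P}\to\mathcal{O}$ and $g\colon\mathcal{Q}\to\mathcal{O}$ be morphisms to an operad $\mathcal{O}$. Then $f(p)$ and $g(q)$ interchange for all operations $p$ of $\mathcal{P}$ and $q$ of $\mathcal{Q}$ if and only if $f(x)$ and $g(y)$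 interchange for all generators $x$ from $\mathcal{X}$ and $y$ from $\mathcal{Y}$. (3) Suppose that $\mathcal{P}$ and $\mathcal{Q}$ act on a set $A$. The two actions interchange, that is, they are the restrictions of an action of $\mathcal{P}\otimes\mathcal{Q}$ on $A$, if and only if the actions of the generators interchange: for all $x\in\mathcal{X}(k)$, $y\in\mathcal{Y}(l)$ and $a_{ij}\in A$ $(1\le i\le k,\ 1\le j\le l)$, $$x\bigl(y(a_{11},\ldots,a_{1l}),\ldots,y(a_{k1},\ldots,a_{kl})\bigr)=y\bigl(x(a_{11},\ldots,a_{k1}),\ldots,x(a_{1l},\ldots,a_{kl})\bigr).$$ -/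

import Mathlib

universe u v w w'

/-- A symmetric collection of sets: a contravariant functor from the groupoid of finite sets and
bijections to sets. Restricting to `ι = Fin n` gives sets with a right action of `S_n`, by
`v.σ = map σ v`. -/
structure SymCollection where
  /-- The set of elements whose inputs are indexed by `ι`. -/
  obj : (ι : Type) → [Finite ι] → Type u
  /-- The contravariant action of bijections. -/
  map : {ι κ : Type} → [Finite ι] → [Finite κ] → (ι ≃ κ) → obj κ → obj ι
  map_refl : ∀ {ι : Type} [Finite ι] (a : obj ι), map (Equiv.refl ι) a = a
  map_trans : ∀ {ι κ τ : Type} [Finite ι] [Finite κ] [Finite τ] (e : ι ≃ κ) (f : κ ≃ τ)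
    (a : obj τ), map (e.trans f) a = map e (map f a)

/-- Morphisms of symmetric collections: natural transformations. -/
structure SymCollection.Hom (A : SymCollection.{u}) (B : SymCollection.{v}) where
  toFun : {ι : Type} → [Finite ι] → A.obj ι → B.obj ι
  map_map : ∀ {ι κ : Type} [Finite ι] [Finite κ] (e : ι ≃ κ) (a : A.obj κ),
    toFun (A.map e a) = B.map e (toFun a)

/-- The composition of morphisms of symmetric collections. -/
def SymCollection.Hom.comp {A : SymCollection.{u}} {B : SymCollection.{v}} {C : SymCollection.{w}}
    (g : B.Hom C) (f : A.Hom B) : A.Hom C where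
  toFun a := g.toFun (f.toFun a)
  map_map e a := by rw [f.map_map, g.map_map]

/-- The disjoint union `A ⊔ B` of two symmetric collections. -/
def SymCollection.sum (A : SymCollection.{u}) (B : SymCollection.{v}) :
    SymCollection.{max u v} where
  obj ι _ := A.obj ι ⊕ B.obj ι
  map e := Sum.map (A.map e) (B.map e)
  map_refl a := by cases a <;> simp [A.map_refl, B.map_refl]
  map_trans e f a := by cases a <;> simp [A.map_trans, B.map_trans]

/-- The inclusion of the first summand. -/
def SymCollection.inl (A : SymCollection.{u}) (B : SymCollection.{v}) : A.Hom (A.sum B) where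
  toFun a := Sum.inl a
  map_map _ _ := rfl

/-- The inclusion of the second summand. -/
def SymCollection.inr (A : SymCollection.{u}) (B : SymCollection.{v}) : B.Hom (A.sum B) where
  toFun a := Sum.inr a
  map_map _ _ := rfl

/-- A symmetric operad in sets. The composition `comp p q` is `γ(p; (q i)_i)`; the inputs of the
composite are the pairs of an input `i` of `p` and an input of `q i`. -/
structure SymOperad extends SymCollection.{u} where
  /-- The identity operation. -/
  one : obj Unit
  /-- The composition `γ`. -/
  comp : {ι : Type} → [Finite ι] → {κ : ι → Type} → [∀ i, Finite (κ i)] →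
    obj ι → ((i : ι) → obj (κ i)) → obj (Σ i, κ i)
  comp_map_left : ∀ {ι ι' : Type} [Finite ι] [Finite ι'] {κ : ι' → Type} [∀ i, Finite (κ i)]
    (e : ι ≃ ι') (p : obj ι') (q : (i : ι') → obj (κ i)),
    comp (map e p) (fun i => q (e i)) = map (Equiv.sigmaCongrLeft (β := κ) e) (comp p q)
  comp_map_right : ∀ {ι : Type} [Finite ι] {κ κ' : ι → Type} [∀ i, Finite (κ i)]
    [∀ i, Finite (κ' i)] (e : (i : ι) → κ i ≃ κ' i) (p : obj ι) (q : (i : ι) → obj (κ' i)),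
    comp p (fun i => map (e i) (q i)) = map (Equiv.sigmaCongrRight e) (comp p q)
  one_comp : ∀ {ι : Type} [Finite ι] (p : obj ι),
    comp one (fun _ => p) = map (Equiv.uniqueSigma fun _ : Unit => ι) p
  comp_one : ∀ {ι : Type} [Finite ι] (p : obj ι),
    comp p (fun _ => one) = map (Equiv.sigmaUnique ι fun _ => Unit) p
  assoc : ∀ {ι : Type} [Finite ι] {κ : ι → Type} [∀ i, Finite (κ i)]
    {τ : (i : ι) → κ i → Type} [∀ i j, Finite (τ i j)]
    (p : obj ι) (q : (i : ι) → obj (κ i)) (r : (i : ι) → (j : κ i) → obj (τ i j)),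
    comp (comp p q) (fun x => r x.1 x.2) =
      map (Equiv.sigmaAssoc τ) (comp p (fun i => comp (q i) (r i)))

namespace SymOperad

/-- Morphisms of symmetric operads. -/
structure Hom (P : SymOperad.{u}) (Q : SymOperad.{v}) extends
    SymCollection.Hom P.toSymCollection Q.toSymCollection where
  map_one : toFun P.one = Q.one
  map_comp : ∀ {ι : Type} [Finite ι] {κ : ι → Type} [∀ i, Finite (κ i)]
    (p : P.obj ι) (q : (i : ι) → P.obj (κ i)),
    toFun (P.comp p q) = Q.comp (toFun p) (fun i => toFun (q i))

/-- The composition of morphisms of operads. -/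
def Hom.comp {P : SymOperad.{u}} {Q : SymOperad.{v}} {O : SymOperad.{w}} (g : Q.Hom O)
    (f : P.Hom Q) : P.Hom O where
  toHom := g.toHom.comp f.toHom
  map_one := (congrArg g.toFun f.map_one).trans g.map_one
  map_comp p q := (congrArg g.toFun (f.map_comp p q)).trans (g.map_comp _ _)

/-- Isomorphisms of symmetric operads. -/
structure Iso (P : SymOperad.{u}) (Q : SymOperad.{v}) where
  hom : P.Hom Q
  inv : Q.Hom P
  inv_hom : ∀ {ι : Type} [Finite ι] (p : P.obj ι), inv.toFun (hom.toFun p) = p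
  hom_inv : ∀ {ι : Type} [Finite ι] (q : Q.obj ι), hom.toFun (inv.toFun q) = q

/-- A family of relations (equations between operations with the same inputs) in an operad. -/
def Relations (O : SymOperad.{u}) : Type (max 1 u) :=
  (ι : Type) → [Finite ι] → O.obj ι → O.obj ι → Prop

/-- A congruence on a set operad (the analogue of an ideal): an equivalence relation compatible
with the action of bijections and with composition. -/
structure Congruence (O : SymOperad.{u}) where
  rel : O.Relations
  equivalence : ∀ (ι : Type) [Finite ι], Equivalence (rel ι)
  map : ∀ {ι κ : Type} [Finite ι] [Finite κ] (e : ι ≃ κ) {p p' : O.obj κ},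
    rel κ p p' → rel ι (O.map e p) (O.map e p')
  comp : ∀ {ι : Type} [Finite ι] {κ : ι → Type} [∀ i, Finite (κ i)] {p p' : O.obj ι}
    {q q' : (i : ι) → O.obj (κ i)}, rel ι p p' → (∀ i, rel (κ i) (q i) (q' i)) →
    rel (Σ i, κ i) (O.comp p q) (O.comp p' q')

/-- The smallest congruence `(R)` containing the relations `R`. -/
def generated {O : SymOperad.{u}} (R : O.Relations) : O.Congruence where
  rel ι _ p p' := ∀ C : O.Congruence,
    (∀ (κ : Type) [Finite κ] (a b : O.obj κ), R κ a b → C.rel κ a b) → C.rel ι p p'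
  equivalence ι _ :=
    ⟨fun p C _ => (C.equivalence ι).refl p, fun h C hC => (C.equivalence ι).symm (h C hC),
      fun h h' C hC => (C.equivalence ι).trans (h C hC) (h' C hC)⟩
  map e _ _ h C hC := C.map e (h C hC)
  comp h h' C hC := C.comp (h C hC) (fun i => h' i C hC)

/-- The setoid of a congruence. -/
def Congruence.setoid {O : SymOperad.{u}} (C : O.Congruence) (ι : Type) [Finite ι] :
    Setoid (O.obj ι) := ⟨C.rel ι, C.equivalence ι⟩

theorem Congruence.out_rel {O : SymOperad.{u}} (C : O.Congruence) {ι : Type} [Finite ι]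
    (p : O.obj ι) : C.rel ι (Quotient.mk (C.setoid ι) p).out p :=
  Quotient.exact (s := C.setoid ι) (Quotient.out_eq _)

theorem Congruence.mk_comp_out {O : SymOperad.{u}} (C : O.Congruence) {ι : Type} [Finite ι]
    {κ : ι → Type} [∀ i, Finite (κ i)] (p : O.obj ι) (q : (i : ι) → O.obj (κ i)) :
    Quotient.mk (C.setoid _) (O.comp (Quotient.mk (C.setoid ι) p).out
      (fun i => (Quotient.mk (C.setoid (κ i)) (q i)).out)) =
    Quotient.mk (C.setoid _) (O.comp p q) :=
  Quotient.sound (s := C.setoid _) (C.comp (C.out_rel p) (fun i => C.out_rel (q i)))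

theorem Congruence.exists_mk {O : SymOperad.{u}} (C : O.Congruence) {ι : Type}
    {κ : ι → Type} [∀ i, Finite (κ i)] (q : (i : ι) → Quotient (C.setoid (κ i))) :
    ∃ q' : (i : ι) → O.obj (κ i), q = fun i => Quotient.mk (C.setoid (κ i)) (q' i) :=
  ⟨fun i => (q i).out, funext fun i => (Quotient.out_eq (q i)).symm⟩

/-- The quotient of an operad by a congruence. -/
noncomputable def quotient (O : SymOperad.{u}) (C : O.Congruence) : SymOperad.{u} where
  obj ι _ := Quotient (C.setoid ι)
  map {ι κ} _ _ e := Quotient.map' (s₁ := C.setoid κ) (s₂ := C.setoid ι) (O.map e)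
    (fun _ _ h => C.map e h)
  map_refl a := by
    induction a using Quotient.inductionOn'
    exact congrArg _ (O.map_refl _)
  map_trans e f a := by
    induction a using Quotient.inductionOn'
    exact congrArg _ (O.map_trans e f _)
  one := Quotient.mk (C.setoid Unit) O.one
  comp p q := Quotient.mk (C.setoid _) (O.comp p.out (fun i => (q i).out))
  comp_map_left {ι ι' _ _ κ _} e p q := by
    induction p using Quotient.inductionOn'
    obtain ⟨q, rfl⟩ := C.exists_mk q
    refine (C.mk_comp_out _ (fun i => q (e i))).trans ?_
    refine Eq.trans ?_ (congrArg _ (C.mk_comp_out _ q).symm)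
    exact congrArg _ (O.comp_map_left e _ q)
  comp_map_right e p q := by
    induction p using Quotient.inductionOn'
    obtain ⟨q, rfl⟩ := C.exists_mk q
    refine (C.mk_comp_out _ (fun i => O.map (e i) (q i))).trans ?_
    refine Eq.trans ?_ (congrArg _ (C.mk_comp_out _ q).symm)
    exact congrArg _ (O.comp_map_right e _ q)
  one_comp p := by
    induction p using Quotient.inductionOn'
    refine (C.mk_comp_out _ (fun _ => _)).trans ?_
    exact congrArg _ (O.one_comp _)
  comp_one p := by
    induction p using Quotient.inductionOn'
    refine (C.mk_comp_out _ (fun _ => _)).trans ?_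
    exact congrArg _ (O.comp_one _)
  assoc {ι _ κ _ τ _} p q r := by
    induction p using Quotient.inductionOn' with | _ p
    obtain ⟨q, rfl⟩ := C.exists_mk q
    obtain ⟨r, rfl⟩ : ∃ r' : (i : ι) → (j : κ i) → O.obj (τ i j),
        r = fun i j => Quotient.mk (C.setoid (τ i j)) (r' i j) :=
      ⟨fun i j => (r i j).out, funext fun i => funext fun j => (Quotient.out_eq (r i j)).symm⟩
    have h := fun i => C.mk_comp_out (q i) (r i)
    have h' := C.mk_comp_out p q
    refine (congrArg (fun z => Quotient.mk (C.setoid _) (O.comp (Quotient.out z) _)) h').trans ?_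
    refine (C.mk_comp_out _ (fun x : Σ i, κ i => r x.1 x.2)).trans ?_
    refine Eq.trans ?_ (congrArg (fun z : (i : ι) → Quotient (C.setoid (Σ j, τ i j)) =>
      Quotient.map' (s₁ := C.setoid _) (s₂ := C.setoid _) (O.map (Equiv.sigmaAssoc τ))
        (fun _ _ h => C.map _ h)
        (Quotient.mk (C.setoid _) (O.comp (Quotient.mk (C.setoid ι) p).out
          (fun i => Quotient.out (z i))))) (funext h)).symm
    refine Eq.trans ?_ (congrArg _ (C.mk_comp_out p (fun i => O.comp (q i) (r i))).symm)
    exact congrArg _ (O.assoc p q r)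

/-- The projection onto the quotient. -/
noncomputable def quotientMk (O : SymOperad.{u}) (C : O.Congruence) : O.Hom (O.quotient C) where
  toFun {ι _} p := Quotient.mk (C.setoid ι) p
  map_map _ _ := rfl
  map_one := rfl
  map_comp p q := (C.mk_comp_out p q).symm

/-- The kernel of a morphism of operads. -/
def Hom.ker {O : SymOperad.{u}} {P : SymOperad.{v}} (f : O.Hom P) : O.Congruence where
  rel _ _ a b := f.toFun a = f.toFun b
  equivalence _ _ := ⟨fun _ => rfl, fun h => h.symm, fun h h' => h.trans h'⟩
  map e _ _ h := by rw [f.map_map, f.map_map, h]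
  comp h h' := by
    rw [f.map_comp, f.map_comp, h]
    exact congrArg _ (funext h')

/-- The morphism induced on a quotient. -/
noncomputable def quotientLift {O : SymOperad.{u}} {P : SymOperad.{v}} (R : O.Relations)
    (f : O.Hom P) (hf : ∀ (ι : Type) [Finite ι] (a b : O.obj ι), R ι a b → f.toFun a = f.toFun b) :
    (O.quotient (generated R)).Hom P where
  toFun {ι _} := Quotient.lift (s := (generated R).setoid ι) f.toFun
    (fun _ _ h => h f.ker hf)
  map_map e a := by
    induction a using Quotient.inductionOn'
    exact f.map_map e _
  map_one := f.map_one
  map_comp p q := by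
    induction p using Quotient.inductionOn'
    obtain ⟨q, rfl⟩ := (generated R).exists_mk q
    refine Eq.trans ?_ (f.map_comp _ q)
    exact congrArg (Quotient.lift (s := (generated R).setoid _) f.toFun
      (fun _ _ h => h f.ker hf)) ((generated R).mk_comp_out _ q)

/-! ### Free operads -/

/-- Terms built from operation symbols `a : A n` of arity `n`, with variables in `ι`. -/
inductive Term (A : ℕ → Type u) (ι : Type) : Type u
  | leaf (i : ι) : Term A ι
  | node {n : ℕ} (a : A n) (t : Fin n → Term A ι) : Term A ι

namespace Term

variable {A : ℕ → Type u} {ι κ τ : Type}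

/-- The type of occurrences of variables in a term. -/
def Pos : Term A ι → Type
  | leaf _ => Unit
  | node _ t => Σ k, (t k).Pos

/-- The variable at an occurrence. -/
def label : (t : Term A ι) → t.Pos → ι
  | leaf i, _ => i
  | node _ t, p => (t p.1).label p.2

/-- Every variable occurs exactly once. -/
def Linear (t : Term A ι) : Prop := Function.Bijective t.label

/-- Substitution. -/
def bind : Term A ι → (ι → Term A κ) → Term A κ
  | leaf i, s => s i
  | node a t, s => node a (fun k => (t k).bind s)

/-- Renaming of variables. -/
def rename (f : ι → κ) (t : Term A ι) : Term A κ := t.bind (fun i => leaf (f i))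

theorem bind_leaf (t : Term A ι) : t.bind leaf = t := by
  induction t with
  | leaf i => rfl
  | node a t ih => exact congrArg _ (funext ih)

theorem bind_bind (t : Term A ι) (s : ι → Term A κ) (r : κ → Term A τ) :
    (t.bind s).bind r = t.bind (fun i => (s i).bind r) := by
  induction t with
  | leaf i => rfl
  | node a t ih => exact congrArg _ (funext ih)

instance finite_pos (t : Term A ι) : Finite t.Pos := by
  induction t with
  | leaf i => exact inferInstanceAs (Finite Unit)
  | node a t ih => exact inferInstanceAs (Finite (Σ k, (t k).Pos))

/-- The occurrences of variables in a substituted term. -/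
def posBind : (t : Term A ι) → (s : ι → Term A κ) →
    (t.bind s).Pos ≃ Σ p : t.Pos, (s (t.label p)).Pos
  | leaf i, s => (Equiv.uniqueSigma fun _ : Unit => (s i).Pos).symm
  | node _ t, s => (Equiv.sigmaCongrRight fun k => (t k).posBind s).trans
      (Equiv.sigmaAssoc fun k p => (s ((t k).label p)).Pos).symm

theorem label_posBind (t : Term A ι) (s : ι → Term A κ) (p : (t.bind s).Pos) :
    (t.bind s).label p = (s (t.label (t.posBind s p).1)).label (t.posBind s p).2 := by
  induction t with
  | leaf i => rfl
  | node a t ih => exact ih p.1 p.2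

theorem Linear.leaf : (Term.leaf () : Term A Unit).Linear :=
  ⟨fun _ _ _ => rfl, fun _ => ⟨(), rfl⟩⟩

theorem Linear.rename {t : Term A ι} (ht : t.Linear) (e : ι ≃ κ) : (t.rename e).Linear := by
  have h : (t.rename e).label = e ∘ t.label ∘ Sigma.fst ∘ t.posBind (fun i => Term.leaf (e i)) :=
    funext fun p => label_posBind t _ p
  unfold Linear
  rw [h]
  refine e.bijective.comp (ht.comp (Function.Bijective.comp ?_ (Equiv.bijective _)))
  exact (Equiv.sigmaUnique t.Pos fun _ => Unit).bijective

/-- Simultaneous substitution of terms in disjoint sets of variables. -/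
def graft {κ : ι → Type} (t : Term A ι) (s : (i : ι) → Term A (κ i)) : Term A (Σ i, κ i) :=
  t.bind (fun i => (s i).rename (Sigma.mk i))

/-- The occurrences of variables in a grafted term. -/
def posGraft {κ : ι → Type} (t : Term A ι) (s : (i : ι) → Term A (κ i)) :
    (t.graft s).Pos ≃ Σ p : t.Pos, (s (t.label p)).Pos :=
  (t.posBind _).trans (Equiv.sigmaCongrRight fun p =>
    ((s (t.label p)).posBind _).trans (Equiv.sigmaUnique _ fun _ => Unit))

theorem label_posGraft {κ : ι → Type} (t : Term A ι) (s : (i : ι) → Term A (κ i))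
    (p : (t.graft s).Pos) : (t.graft s).label p =
      ⟨t.label (t.posGraft s p).1, (s _).label (t.posGraft s p).2⟩ :=
  (label_posBind t _ p).trans (label_posBind _ _ _)

/-- The variables are the occurrences, for a linear term. -/
noncomputable def Linear.equiv {t : Term A ι} (ht : t.Linear) : t.Pos ≃ ι :=
  Equiv.ofBijective t.label ht

theorem Linear.graft {κ : ι → Type} {t : Term A ι} {s : (i : ι) → Term A (κ i)} (ht : t.Linear)
    (hs : ∀ i, (s i).Linear) : (t.graft s).Linear := by
  have h : (t.graft s).label = (t.posGraft s).trans
      ((Equiv.sigmaCongrRight fun p => (hs (t.label p)).equiv).trans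
        (Equiv.sigmaCongrLeft (β := κ) ht.equiv)) :=
    funext fun p => label_posGraft t s p
  unfold Linear
  rw [h]
  exact Equiv.bijective _

end Term

/-- The operad of linear terms: the free symmetric operad on operation symbols without
symmetries. -/
def termOperad (A : ℕ → Type u) : SymOperad.{u} where
  obj ι _ := {t : Term A ι // t.Linear}
  map e t := ⟨t.1.rename e.symm, t.2.rename e.symm⟩
  map_refl a := Subtype.ext (Term.bind_leaf a.1)
  map_trans e f a := Subtype.ext (Term.bind_bind a.1 (fun i => Term.leaf (f.symm i))
    (fun j => Term.leaf (e.symm j))).symm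
  one := ⟨Term.leaf (), Term.Linear.leaf⟩
  comp p q := ⟨p.1.graft (fun i => (q i).1), p.2.graft (fun i => (q i).2)⟩
  comp_map_left {ι ι' _ _ κ _} e p q := Subtype.ext <| by
    refine (Term.bind_bind p.1 _ _).trans (Eq.trans ?_ (Term.bind_bind p.1 _ _).symm)
    refine congrArg _ (funext fun i' => ?_)
    obtain ⟨i, rfl⟩ := e.surjective i'
    refine Eq.trans ?_ (Term.bind_bind (q (e i)).1 _ _).symm
    have h1 : ∀ i' : ι, i' = i → Term.rename (Sigma.mk (β := fun i => κ (e i)) i') (q (e i')).1 =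
        Term.rename (Sigma.mk (β := fun i => κ (e i)) i) (q (e i)).1 := by
      rintro _ rfl; rfl
    refine (h1 _ (e.symm_apply_apply i)).trans ?_
    refine congrArg _ (funext fun j => ?_)
    refine congrArg Term.leaf ?_
    exact ((Equiv.symm_apply_eq (Equiv.sigmaCongrLeft (β := κ) e)).2 rfl).symm
  comp_map_right e p q := Subtype.ext <| by
    refine Eq.trans ?_ (Term.bind_bind p.1 _ _).symm
    refine congrArg _ (funext fun i => ?_)
    exact (Term.bind_bind (q i).1 _ _).trans
      (Term.bind_bind (q i).1 (fun j => Term.leaf (Sigma.mk i j))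
        (fun x => Term.leaf ((Equiv.sigmaCongrRight e).symm x))).symm
  one_comp p := rfl
  comp_one p := rfl
  assoc {ι _ κ _ τ _} p q r := Subtype.ext <| by
    refine (Term.bind_bind p.1 _ _).trans (Eq.trans ?_ (Term.bind_bind p.1 _ _).symm)
    refine congrArg _ (funext fun i => ?_)
    refine (Term.bind_bind (q i).1 _ _).trans ?_
    refine Eq.trans ?_ (Term.bind_bind _ _ _).symm
    refine Eq.trans ?_ (Term.bind_bind (q i).1 _ _).symm
    refine congrArg _ (funext fun j => ?_)
    exact (Term.bind_bind (r i j).1 (fun k => Term.leaf (Sigma.mk j k))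
      (fun x => Term.leaf ((Equiv.sigmaAssoc τ).symm ⟨i, x⟩))).symm

/-- The term `a(1, …, n)` for an operation symbol `a` of arity `n`. -/
def corolla {A : ℕ → Type u} {n : ℕ} (a : A n) : (termOperad A).obj (Fin n) :=
  ⟨Term.node a Term.leaf, (Equiv.sigmaUnique (Fin n) fun _ => Unit).bijective⟩

/-- The relations identifying `x.σ`, as an operation symbol, with the result of the action of `σ`
on the operation symbol `x`. -/
inductive SymRel (X : SymCollection.{u}) : (termOperad fun n => X.obj (Fin n)).Relations
  | mk {n : ℕ} (σ : Equiv.Perm (Fin n)) (x : X.obj (Fin n)) :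
      SymRel X (Fin n) (corolla (A := fun n => X.obj (Fin n)) (X.map σ x))
        ((termOperad fun n => X.obj (Fin n)).map σ (corolla (A := fun n => X.obj (Fin n)) x))

/-- The free operad `T(X)` generated by a symmetric collection `X`: linear terms (trees with
vertices decorated by elements of `X` and leaves labelled bijectively by the inputs), modulo the
symmetries of the decorations. -/
noncomputable def free (X : SymCollection.{u}) : SymOperad.{u} :=
  (termOperad fun n => X.obj (Fin n)).quotient (generated (SymRel X))

/-- A generator with inputs numbered `1, …, n`, as an element of the free operad. -/
noncomputable def freeCorolla (X : SymCollection.{u}) {n : ℕ} (x : X.obj (Fin n)) :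
    (free X).obj (Fin n) :=
  (quotientMk _ (generated (SymRel X))).toFun (corolla (A := fun n => X.obj (Fin n)) x)

theorem freeCorolla_map (X : SymCollection.{u}) {n : ℕ} (σ : Equiv.Perm (Fin n))
    (x : X.obj (Fin n)) : freeCorolla X (X.map σ x) = (free X).map σ (freeCorolla X x) :=
  Quotient.sound (s := (generated (SymRel X)).setoid _) (fun _ hC => hC _ _ _ (SymRel.mk σ x))

theorem freeCorolla_indep (X : SymCollection.{u}) {ι : Type} [Finite ι] {n m : ℕ}
    (e : ι ≃ Fin n) (f : ι ≃ Fin m) (x : X.obj ι) :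
    (free X).map e (freeCorolla X (X.map e.symm x)) =
      (free X).map f (freeCorolla X (X.map f.symm x)) := by
  obtain rfl : n = m := Fin.equiv_iff_eq.1 ⟨e.symm.trans f⟩
  have h : e.symm = (e.symm.trans f).trans f.symm := by ext; simp
  rw [h, X.map_trans, freeCorolla_map, ← (free X).map_trans]
  congr 1
  ext; simp

/-- The inclusion of the generators in the free operad. The elements of `X ι` are turned into
elements of `X (Fin n)` by numbering `ι`; the result does not depend on the numbering. -/
noncomputable def gen (X : SymCollection.{u}) : X.Hom (free X).toSymCollection where
  toFun {ι _} x :=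
    (free X).map (Finite.equivFin ι) (freeCorolla X (X.map (Finite.equivFin ι).symm x))
  map_map {ι κ _ _} e x := by
    rw [← (free X).map_trans,
      freeCorolla_indep X (Finite.equivFin ι) (e.trans (Finite.equivFin κ)) (X.map e x),
      ← X.map_trans]
    congr 3
    ext; simp

/-- The value in an operad of a term, with inputs indexed by the occurrences of variables. -/
def evalPos {A : ℕ → Type u} (O : SymOperad.{v}) (f : {n : ℕ} → A n → O.obj (Fin n)) {ι : Type} :
    (t : Term A ι) → O.obj t.Pos
  | Term.leaf _ => O.one
  | Term.node a t => O.comp (f a) (fun k => evalPos O f (t k))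

theorem map_map_eq (O : SymOperad.{v}) {ι κ τ : Type} [Finite ι] [Finite κ] [Finite τ]
    (e : ι ≃ κ) (f : κ ≃ τ) (g : ι ≃ τ) (h : ∀ i, f (e i) = g i) (a : O.obj τ) :
    O.map e (O.map f a) = O.map g a :=
  (O.map_trans e f a).symm.trans (congrArg (fun g => O.map g a) (Equiv.ext h))

theorem comp_map_right_eq (O : SymOperad.{v}) {ι : Type} [Finite ι] {κ κ' : ι → Type}
    [∀ i, Finite (κ i)] [∀ i, Finite (κ' i)] (e : (i : ι) → κ i ≃ κ' i) (p : O.obj ι)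
    {q : (i : ι) → O.obj (κ i)} {q' : (i : ι) → O.obj (κ' i)}
    (h : ∀ i, q i = O.map (e i) (q' i)) :
    O.comp p q = O.map (Equiv.sigmaCongrRight e) (O.comp p q') := by
  rw [← O.comp_map_right]
  exact congrArg _ (funext h)

theorem evalPos_bind {A : ℕ → Type u} (O : SymOperad.{v})
    (f : {n : ℕ} → A n → O.obj (Fin n)) {ι κ : Type} (t : Term A ι) (s : ι → Term A κ) :
    evalPos O f (t.bind s) =
      O.map (t.posBind s) (O.comp (evalPos O f t) (fun p => evalPos O f (s (t.label p)))) := by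
  induction t with
  | leaf i =>
    refine Eq.trans ?_ (congrArg (O.map (Equiv.uniqueSigma fun _ : Unit => (s i).Pos).symm)
      (O.one_comp (evalPos O f (s i))).symm)
    exact ((O.map_map_eq _ _ (Equiv.refl _) (Equiv.apply_symm_apply _) _).trans
      (O.map_refl _)).symm
  | node a t ih =>
    refine (O.comp_map_right_eq (fun k => (t k).posBind s) (f a) ih).trans ?_
    refine Eq.trans ?_ (congrArg (O.map ((Equiv.sigmaCongrRight fun k => (t k).posBind s).trans
      (Equiv.sigmaAssoc fun k p => (s ((t k).label p)).Pos).symm))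
      (O.assoc (f a) (fun k => evalPos O f (t k))
        (fun k p => evalPos O f (s ((t k).label p)))).symm)
    exact (O.map_map_eq _ _ _ (fun x => Equiv.apply_symm_apply _ _) _).symm

theorem evalPos_rename {A : ℕ → Type u} (O : SymOperad.{v})
    (f : {n : ℕ} → A n → O.obj (Fin n)) {ι κ : Type} (t : Term A ι) (e : ι → κ) :
    evalPos O f (t.rename e) =
      O.map ((t.posBind _).trans (Equiv.sigmaUnique _ fun _ => Unit)) (evalPos O f t) := by
  refine (evalPos_bind O f t _).trans ?_
  refine (congrArg (O.map (t.posBind _)) (O.comp_one (evalPos O f t))).trans ?_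
  exact O.map_map_eq _ _ _ (fun _ => rfl) _

theorem evalPos_graft {A : ℕ → Type u} (O : SymOperad.{v})
    (f : {n : ℕ} → A n → O.obj (Fin n)) {ι : Type} {κ : ι → Type} (t : Term A ι)
    (s : (i : ι) → Term A (κ i)) :
    evalPos O f (t.graft s) =
      O.map (t.posGraft s) (O.comp (evalPos O f t) (fun p => evalPos O f (s (t.label p)))) := by
  refine (evalPos_bind O f t _).trans ?_
  refine (congrArg (O.map (t.posBind _))
    (O.comp_map_right_eq _ _ (fun p => evalPos_rename O f (s (t.label p)) _))).trans ?_
  exact O.map_map_eq _ _ _ (fun _ => rfl) _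

/-- The morphism from the operad of linear terms given by an interpretation of the symbols. -/
noncomputable def termLift {A : ℕ → Type u} (O : SymOperad.{v})
    (f : {n : ℕ} → A n → O.obj (Fin n)) : (termOperad A).Hom O where
  toFun {ι _} (t : {t : Term A ι // t.Linear}) := O.map t.2.equiv.symm (evalPos O f t.1)
  map_map {ι κ _ _} e (t : {t : Term A κ // t.Linear}) := by
    let t' : {t : Term A ι // t.Linear} := ⟨t.1.rename e.symm, t.2.rename e.symm⟩
    change O.map t'.2.equiv.symm (evalPos O f t'.1) = O.map e (O.map t.2.equiv.symm _)
    refine (congrArg _ (evalPos_rename O f t.1 e.symm)).trans ?_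
    refine (O.map_map_eq _ _ (e.trans t.2.equiv.symm) ?_ _).trans (O.map_trans _ _ _)
    intro i
    obtain ⟨p, rfl⟩ := t'.2.equiv.surjective i
    rw [Equiv.symm_apply_apply]
    have h : t'.2.equiv p = e.symm (t.1.label _) := Term.label_posBind t.1 _ p
    rw [h]
    refine (t.2.equiv.symm_apply_apply _).symm.trans ?_
    exact congrArg t.2.equiv.symm (e.apply_symm_apply _).symm
  map_one := by
    refine Eq.trans ?_ (O.map_refl _)
    exact congrArg (fun g : Unit ≃ Unit => O.map g O.one) (Equiv.ext fun _ => rfl)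
  map_comp {ι _ κ _} (p : {t : Term A ι // t.Linear})
      (q : (i : ι) → {t : Term A (κ i) // t.Linear}) := by
    let t : {t : Term A (Σ i, κ i) // t.Linear} :=
      ⟨p.1.graft (fun i => (q i).1), p.2.graft (fun i => (q i).2)⟩
    change O.map t.2.equiv.symm (evalPos O f t.1) = _
    let L := p.2.equiv
    let P := O.map L.symm (evalPos O f p.1)
    let M := fun i => (q i).2.equiv
    let Q := fun i => O.map (M i).symm (evalPos O f (q i).1)
    have hP : O.map L P = evalPos O f p.1 :=
      (O.map_map_eq _ _ (Equiv.refl _) (fun _ => Equiv.symm_apply_apply _ _) _).trans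
        (O.map_refl _)
    have hQ : ∀ i, O.map (M i) (Q i) = evalPos O f (q i).1 := fun i =>
      (O.map_map_eq _ _ (Equiv.refl _) (fun _ => Equiv.symm_apply_apply _ _) _).trans
        (O.map_refl _)
    have h1 : O.comp (evalPos O f p.1) (fun x => evalPos O f (q (L x)).1) =
        O.map (Equiv.sigmaCongrLeft (β := fun i => (q i).1.Pos) L)
          (O.comp P (fun i => evalPos O f (q i).1)) := by
      rw [← hP]
      exact O.comp_map_left L P (fun i => evalPos O f (q i).1)
    have h2 : O.comp P (fun i => evalPos O f (q i).1) =
        O.map (Equiv.sigmaCongrRight M) (O.comp P Q) :=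
      O.comp_map_right_eq M P (fun i => (hQ i).symm)
    refine (congrArg (O.map t.2.equiv.symm) ((evalPos_graft O f p.1 (fun i => (q i).1)).trans
      (congrArg (O.map (p.1.posGraft (fun i => (q i).1)))
        (h1.trans (congrArg (O.map (Equiv.sigmaCongrLeft (β := fun i => (q i).1.Pos) L))
          h2))))).trans ?_
    refine (congrArg (O.map t.2.equiv.symm) ((congrArg (O.map (p.1.posGraft (fun i => (q i).1)))
      (O.map_map_eq _ _ ((Equiv.sigmaCongrLeft (β := fun i => (q i).1.Pos) L).trans
        (Equiv.sigmaCongrRight M)) (fun _ => rfl) _)).trans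
        (O.map_map_eq _ _ t.2.equiv ?_ _))).trans ?_
    · intro x
      exact (Term.label_posGraft p.1 (fun i => (q i).1) x).symm
    · exact (O.map_map_eq _ _ (Equiv.refl _) (fun _ => Equiv.apply_symm_apply _ _) _).trans
        (O.map_refl _)

theorem termLift_corolla {A : ℕ → Type u} (O : SymOperad.{v})
    (f : {n : ℕ} → A n → O.obj (Fin n)) {n : ℕ} (a : A n) :
    (termLift O f).toFun (corolla a) = f a := by
  have h : evalPos O f (corolla a).1 = O.map (Equiv.sigmaUnique (Fin n) fun _ => Unit) (f a) :=
    O.comp_one (f a)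
  refine (congrArg _ h).trans ((O.map_map_eq _ _ (Equiv.refl _) ?_ _).trans (O.map_refl _))
  intro i
  exact (corolla a).2.equiv.apply_symm_apply i

/-- The morphism from the free operad `T(X)` extending a morphism of collections on `X`. -/
noncomputable def freeLift {X : SymCollection.{u}} {O : SymOperad.{v}}
    (f : X.Hom O.toSymCollection) : (free X).Hom O :=
  quotientLift (SymRel X) (termLift O (fun x => f.toFun x)) (by
    rintro _ _ _ _ ⟨σ, x⟩
    rw [(termLift O _).map_map, termLift_corolla, termLift_corolla, f.map_map])

theorem freeLift_gen {X : SymCollection.{u}} {O : SymOperad.{v}}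
    (f : X.Hom O.toSymCollection) {ι : Type} [Finite ι] (x : X.obj ι) :
    (freeLift f).toFun ((gen X).toFun x) = f.toFun x := by
  refine ((freeLift f).map_map (Finite.equivFin ι)
    (freeCorolla X (X.map (Finite.equivFin ι).symm x))).trans ?_
  refine (congrArg (O.map (Finite.equivFin ι)) (termLift_corolla O (fun x => f.toFun x) _)).trans ?_
  rw [f.map_map]
  exact (O.map_map_eq _ _ (Equiv.refl _) (fun _ => Equiv.symm_apply_apply _ _) _).trans
    (O.map_refl _)

theorem termHom_ext {A : ℕ → Type u} {O : SymOperad.{v}} (φ ψ : (termOperad A).Hom O)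
    (h : ∀ (n : ℕ) (a : A n), φ.toFun (corolla a) = ψ.toFun (corolla a)) {ι : Type} [Finite ι]
    (t : (termOperad A).obj ι) : φ.toFun t = ψ.toFun t := by
  have h1 : ∀ {κ : Type} (s : Term A κ), φ.toFun (evalPos (termOperad A) corolla s) =
      ψ.toFun (evalPos (termOperad A) corolla s) := by
    intro κ s
    induction s with
    | leaf i => exact φ.map_one.trans ψ.map_one.symm
    | node a s ih =>
      refine (φ.map_comp _ _).trans (Eq.trans ?_ (ψ.map_comp _ _).symm)
      rw [h, funext ih]
  have h2 : ∀ {κ : Type} (s : Term A κ),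
      (evalPos (termOperad A) corolla s).1.rename s.label = s := by
    intro κ s
    induction s with
    | leaf i => rfl
    | node a s ih =>
      refine congrArg (Term.node a) (funext fun k => ?_)
      exact (Term.bind_bind (evalPos (termOperad A) corolla (s k)).1
        (fun p => Term.leaf (Sigma.mk (β := fun k => (s k).Pos) k p))
        (fun x => Term.leaf ((s x.1).label x.2))).trans (ih k)
  have h3 : t = (termOperad A).map t.2.equiv.symm (evalPos (termOperad A) corolla t.1) :=
    Subtype.ext (h2 t.1).symm
  rw [h3, φ.map_map, ψ.map_map, h1]

/-- Two morphisms from a free operad which agree on generators are equal. -/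
theorem freeHom_ext {X : SymCollection.{u}} {O : SymOperad.{v}} (φ ψ : (free X).Hom O)
    (h : ∀ (ι : Type) [Finite ι] (x : X.obj ι),
      φ.toFun ((gen X).toFun x) = ψ.toFun ((gen X).toFun x)) {ι : Type} [Finite ι]
    (t : (free X).obj ι) : φ.toFun t = ψ.toFun t := by
  have h1 : ∀ (n : ℕ) (x : X.obj (Fin n)),
      φ.toFun (freeCorolla X x) = ψ.toFun (freeCorolla X x) := by
    intro n x
    have hx : freeCorolla X x = (gen X).toFun x := by
      refine Eq.trans ?_ (freeCorolla_indep X (Equiv.refl (Fin n)) (Finite.equivFin (Fin n)) x)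
      rw [(free X).map_refl]
      exact congrArg _ (X.map_refl x).symm
    rw [hx, h]
  induction t using Quotient.inductionOn' with | _ t
  exact termHom_ext (φ.comp (quotientMk _ _)) (ψ.comp (quotientMk _ _)) h1 t

/-! ### The coproduct and the Boardman–Vogt tensor product -/

/-- The image of relations under a morphism. -/
inductive Relations.image {O : SymOperad.{u}} {P : SymOperad.{v}} (f : O.Hom P)
    (R : O.Relations) : P.Relations
  | mk {ι : Type} [Finite ι] (a b : O.obj ι) (h : R ι a b) :
      Relations.image f R ι (f.toFun a) (f.toFun b)

/-- The union of two families of relations. -/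
def Relations.union {O : SymOperad.{u}} (R S : O.Relations) : O.Relations :=
  fun ι _ a b => R ι a b ∨ S ι a b

/-- The relations making a morphism of collections `f` a morphism of operads. -/
inductive HomRel (P : SymOperad.{u}) (O : SymOperad.{v})
    (f : P.toSymCollection.Hom O.toSymCollection) : O.Relations
  | one : HomRel P O f Unit (f.toFun P.one) O.one
  | comp {ι : Type} [Finite ι] {κ : ι → Type} [∀ i, Finite (κ i)] (p : P.obj ι)
      (q : (i : ι) → P.obj (κ i)) :
      HomRel P O f (Σ i, κ i) (f.toFun (P.comp p q)) (O.comp (f.toFun p) (fun i => f.toFun (q i)))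

/-- The relations of the coproduct of `P` and `Q` between elements of `P` and of `Q`: all
compositions in `P` and in `Q`. -/
def coprodRel (P : SymOperad.{u}) (Q : SymOperad.{v}) :
    (free (P.toSymCollection.sum Q.toSymCollection)).Relations :=
  (HomRel P _ ((gen _).comp (SymCollection.inl P.toSymCollection Q.toSymCollection))).union
    (HomRel Q _ ((gen _).comp (SymCollection.inr P.toSymCollection Q.toSymCollection)))

/-- The coproduct (free product) `P ⊔ Q` of operads: the operad generated by the elements of `P`
and of `Q` subject to the compositions in `P` and in `Q`. -/
noncomputable def coprod (P : SymOperad.{u}) (Q : SymOperad.{v}) : SymOperad.{max u v} :=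
  (free (P.toSymCollection.sum Q.toSymCollection)).quotient (generated (coprodRel P Q))

theorem quotientMk_eq {O : SymOperad.{u}} {R : O.Relations} {ι : Type} [Finite ι] {a b : O.obj ι}
    (h : R ι a b) : (O.quotientMk (generated R)).toFun a = (O.quotientMk (generated R)).toFun b :=
  Quotient.sound (s := (generated R).setoid ι) (fun _ hC => hC ι a b h)

/-- The inclusion of the first factor in the coproduct. -/
noncomputable def coprodInl (P : SymOperad.{u}) (Q : SymOperad.{v}) : P.Hom (coprod P Q) where
  toHom := (quotientMk _ _).toHom.comp ((gen _).comp (SymCollection.inl _ _))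
  map_one := quotientMk_eq (Or.inl HomRel.one)
  map_comp p q := (quotientMk_eq (Or.inl (HomRel.comp p q))).trans
    ((quotientMk _ (generated (coprodRel P Q))).map_comp _ _)

/-- The inclusion of the second factor in the coproduct. -/
noncomputable def coprodInr (P : SymOperad.{u}) (Q : SymOperad.{v}) : Q.Hom (coprod P Q) where
  toHom := (quotientMk _ _).toHom.comp ((gen _).comp (SymCollection.inr _ _))
  map_one := quotientMk_eq (Or.inr HomRel.one)
  map_comp p q := (quotientMk_eq (Or.inr (HomRel.comp p q))).trans
    ((quotientMk _ (generated (coprodRel P Q))).map_comp _ _)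

/-- The universal property of the coproduct. -/
theorem coprod_universal (P : SymOperad.{u}) (Q : SymOperad.{v}) (O : SymOperad.{w})
    (f : P.Hom O) (g : Q.Hom O) :
    (∃ h : (coprod P Q).Hom O,
      (∀ (ι : Type) [Finite ι] (p : P.obj ι), h.toFun ((coprodInl P Q).toFun p) = f.toFun p) ∧
      (∀ (ι : Type) [Finite ι] (q : Q.obj ι), h.toFun ((coprodInr P Q).toFun q) = g.toFun q)) ∧
    ∀ h h' : (coprod P Q).Hom O,
      (∀ (ι : Type) [Finite ι] (p : P.obj ι),
        h.toFun ((coprodInl P Q).toFun p) = h'.toFun ((coprodInl P Q).toFun p)) →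
      (∀ (ι : Type) [Finite ι] (q : Q.obj ι),
        h.toFun ((coprodInr P Q).toFun q) = h'.toFun ((coprodInr P Q).toFun q)) →
      ∀ (ι : Type) [Finite ι] (t : (coprod P Q).obj ι), h.toFun t = h'.toFun t := by
  let k : (P.toSymCollection.sum Q.toSymCollection).Hom O.toSymCollection :=
    { toFun := fun a => Sum.elim f.toFun g.toFun a
      map_map := fun e a => by
        rcases a with a | a
        · exact f.map_map e a
        · exact g.map_map e a }
  have hl : ∀ {ι : Type} [Finite ι] (p : P.obj ι), (freeLift k).toFun
      (((gen _).comp (SymCollection.inl _ _)).toFun p) = f.toFun p :=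
    fun p => freeLift_gen k (Sum.inl p)
  have hr : ∀ {ι : Type} [Finite ι] (q : Q.obj ι), (freeLift k).toFun
      (((gen _).comp (SymCollection.inr _ _)).toFun q) = g.toFun q :=
    fun q => freeLift_gen k (Sum.inr q)
  refine ⟨⟨quotientLift (coprodRel P Q) (freeLift k) ?_, fun ι _ p => hl p, fun ι _ q => hr q⟩, ?_⟩
  · rintro _ _ _ _ (h | h) <;> rcases h with _ | ⟨p, q⟩
    · rw [hl, (freeLift k).map_one, f.map_one]
    · rw [hl, (freeLift k).map_comp, f.map_comp]
      simp only [hl]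
    · rw [hr, (freeLift k).map_one, g.map_one]
    · rw [hr, (freeLift k).map_comp, g.map_comp]
      simp only [hr]
  · intro h h' h1 h2 ι _ t
    induction t using Quotient.inductionOn' with | _ t
    refine freeHom_ext (h.comp (quotientMk _ _)) (h'.comp (quotientMk _ _)) ?_ t
    rintro κ _ (x | x)
    · exact h1 κ x
    · exact h2 κ x

/-- The exchange of rows and columns `σ_{k,l}`, sending the pair `(i, j)` to `(j, i)`. -/
def exchange (ι κ : Type) : (Σ _ : ι, κ) ≃ (Σ _ : κ, ι) where
  toFun x := ⟨x.2, x.1⟩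
  invFun x := ⟨x.2, x.1⟩
  left_inv _ := rfl
  right_inv _ := rfl

/-- Two operations interchange: `γ(p; q, …, q) = γ(q; p, …, p).σ`. -/
def Interchange (O : SymOperad.{u}) {ι κ : Type} [Finite ι] [Finite κ] (p : O.obj ι)
    (q : O.obj κ) : Prop :=
  O.comp p (fun _ => q) = O.map (exchange ι κ) (O.comp q (fun _ => p))

/-- The interchange relations between the images of two collections in an operad. -/
inductive InterchangeRel (O : SymOperad.{u}) {A : SymCollection.{v}} {B : SymCollection.{w}}
    (f : A.Hom O.toSymCollection) (g : B.Hom O.toSymCollection) : O.Relations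
  | mk {ι κ : Type} [Finite ι] [Finite κ] (a : A.obj ι) (b : B.obj κ) :
      InterchangeRel O f g (Σ _ : ι, κ) (O.comp (f.toFun a) (fun _ => g.toFun b))
        (O.map (exchange ι κ) (O.comp (g.toFun b) (fun _ => f.toFun a)))

/-- The Boardman–Vogt tensor product `P ⊗ Q`: the quotient of the coproduct by the congruence
generated by the interchange relations between all elements of `P` and all elements of `Q`. -/
noncomputable def tensor (P : SymOperad.{u}) (Q : SymOperad.{v}) : SymOperad.{max u v} :=
  (coprod P Q).quotient
    (generated (InterchangeRel (coprod P Q) (coprodInl P Q).toHom (coprodInr P Q).toHom))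

/-- The canonical morphism `P → P ⊗ Q`. -/
noncomputable def tensorInl (P : SymOperad.{u}) (Q : SymOperad.{v}) : P.Hom (tensor P Q) :=
  (quotientMk _ _).comp (coprodInl P Q)

/-- The canonical morphism `Q → P ⊗ Q`. -/
noncomputable def tensorInr (P : SymOperad.{u}) (Q : SymOperad.{v}) : Q.Hom (tensor P Q) :=
  (quotientMk _ _).comp (coprodInr P Q)

/-! ### Presentations -/

/-- The operad `T(X)/(R)` with generators `X` and relations `R`. -/
noncomputable def presented (X : SymCollection.{u}) (R : (free X).Relations) : SymOperad.{u} :=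
  (free X).quotient (generated R)

/-- The projection `T(X) → T(X)/(R)`. -/
noncomputable def presentedMk (X : SymCollection.{u}) (R : (free X).Relations) :
    (free X).Hom (presented X R) :=
  quotientMk _ _

/-- The morphism `T(X) → T(X ⊔ Y)` induced by the inclusion. -/
noncomputable def freeInl (X : SymCollection.{u}) (Y : SymCollection.{v}) :
    (free X).Hom (free (X.sum Y)) :=
  freeLift ((gen (X.sum Y)).comp (X.inl Y))

/-- The morphism `T(Y) → T(X ⊔ Y)` induced by the inclusion. -/
noncomputable def freeInr (X : SymCollection.{u}) (Y : SymCollection.{v}) :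
    (free Y).Hom (free (X.sum Y)) :=
  freeLift ((gen (X.sum Y)).comp (X.inr Y))

/-- The relations `R ⊔ S ⊔ IC` in `T(X ⊔ Y)`, where `IC` consists of the interchange relations
between the generators in `X` and the generators in `Y`. -/
noncomputable def tensorRel {X : SymCollection.{u}} {Y : SymCollection.{v}}
    (R : (free X).Relations) (S : (free Y).Relations) : (free (X.sum Y)).Relations :=
  ((R.image (freeInl X Y)).union (S.image (freeInr X Y))).union
    (InterchangeRel (free (X.sum Y)) ((gen (X.sum Y)).comp (X.inl Y))
      ((gen (X.sum Y)).comp (X.inr Y)))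

/-! ### Algebras -/

/-- The endomorphism operad of a set. An action of an operad `P` on `A` is a morphism
`P.Hom (endOperad A)`. -/
def endOperad (A : Type u) : SymOperad.{u} where
  obj ι _ := (ι → A) → A
  map e f a := f (fun k => a (e.symm k))
  map_refl _ := rfl
  map_trans _ _ _ := rfl
  one a := a ()
  comp p q a := p (fun i => q i (fun j => a ⟨i, j⟩))
  comp_map_left {ι ι' _ _ κ _} e p q := by
    funext a
    refine congrArg p (funext fun i' => ?_)
    obtain ⟨i, rfl⟩ := e.surjective i'
    have h1 : ∀ i' : ι, i' = i → q (e i') (fun j => a ⟨i', j⟩) = q (e i) (fun j => a ⟨i, j⟩) := by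
      rintro _ rfl; rfl
    refine (h1 _ (e.symm_apply_apply i)).trans ?_
    refine congrArg (q (e i)) (funext fun j => congrArg a ?_)
    exact ((Equiv.symm_apply_eq (Equiv.sigmaCongrLeft (β := κ) e)).2 rfl).symm
  comp_map_right _ _ _ := rfl
  one_comp _ := rfl
  comp_one _ := rfl
  assoc _ _ _ := rfl

end SymOperad

/-! The heart of the matter is that the operations interchanging with a fixed operation `r` form a
suboperad. The identity interchanges with everything, relabelling inputs does no harm
(`Interchange.map_left`), and a composite `γ(p; q_i)` interchanges with `r` as soon as `p` and all
the `q_i` do: by associativity `r` can be moved first past the `q_i` and then past `p`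
(`Interchange.comp_left`). Interchange is symmetric, so the same holds in the other argument.

A suboperad containing the images of the generators contains the image of the whole free operad
(`free_induction`). Using this once in each argument passes from generators to all elements of two
free operads (`interchange_of_gen`), and, since `T(X) → P` and `T(Y) → Q` are surjective, to all
operations of `P` and `Q`. This is (2).

For (3), the tensor product has the universal property that a pair of morphisms extends to it
exactly when their images interchange (`exists_tensorLift_iff`). Combined with (2) for the
endomorphism operad of `A`, this leaves an identity between functions on arrays.

For (1), mutually inverse morphisms are built. The one out of `P ⊗ Q` is where (2) is needed: the
presented operad imposes interchange on generators only, while the tensor product asks for it on all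
operations. The one out of the presented operad exists because `R`, `S` and `IC` all hold in `P ⊗
Q`. The composites are identities because they fix the images of the generators. -/

namespace SymOperad

/-! ### Suboperads and induction over a free operad -/

/-- The suboperad of the operations satisfying a property closed under the operad structure. -/
def suboperad (O : SymOperad.{u}) (M : (ι : Type) → [Finite ι] → O.obj ι → Prop)
    (hmap : ∀ {ι κ : Type} [Finite ι] [Finite κ] (e : ι ≃ κ) (p : O.obj κ),
      M κ p → M ι (O.map e p))
    (hone : M Unit O.one)
    (hcomp : ∀ {ι : Type} [Finite ι] {κ : ι → Type} [∀ i, Finite (κ i)] (p : O.obj ι)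
      (q : (i : ι) → O.obj (κ i)), M ι p → (∀ i, M (κ i) (q i)) →
      M (Σ i, κ i) (O.comp p q)) : SymOperad.{u} where
  obj ι _ := {p : O.obj ι // M ι p}
  map e p := ⟨O.map e p.1, hmap e p.1 p.2⟩
  map_refl p := Subtype.ext (O.map_refl p.1)
  map_trans e f p := Subtype.ext (O.map_trans e f p.1)
  one := ⟨O.one, hone⟩
  comp p q := ⟨O.comp p.1 (fun i => (q i).1), hcomp _ _ p.2 (fun i => (q i).2)⟩
  comp_map_left e p q := Subtype.ext (O.comp_map_left e p.1 (fun i => (q i).1))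
  comp_map_right e p q := Subtype.ext (O.comp_map_right e p.1 (fun i => (q i).1))
  one_comp p := Subtype.ext (O.one_comp p.1)
  comp_one p := Subtype.ext (O.comp_one p.1)
  assoc p q r := Subtype.ext (O.assoc p.1 (fun i => (q i).1) (fun i j => (r i j).1))

/-- A property closed under the operad structure which holds for the images of the generators
holds for the images of all elements of a free operad. -/
theorem free_induction {X : SymCollection.{u}} {O : SymOperad.{v}} (φ : (free X).Hom O)
    (M : (ι : Type) → [Finite ι] → O.obj ι → Prop)
    (hmap : ∀ {ι κ : Type} [Finite ι] [Finite κ] (e : ι ≃ κ) (p : O.obj κ),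
      M κ p → M ι (O.map e p))
    (hone : M Unit O.one)
    (hcomp : ∀ {ι : Type} [Finite ι] {κ : ι → Type} [∀ i, Finite (κ i)] (p : O.obj ι)
      (q : (i : ι) → O.obj (κ i)), M ι p → (∀ i, M (κ i) (q i)) →
      M (Σ i, κ i) (O.comp p q))
    (hgen : ∀ (ι : Type) [Finite ι] (x : X.obj ι), M ι (φ.toFun ((gen X).toFun x)))
    {ι : Type} [Finite ι] (t : (free X).obj ι) : M ι (φ.toFun t) := by
  let N := O.suboperad M hmap hone hcomp
  let incl : N.Hom O :=
    { toFun := fun p => p.1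
      map_map := fun _ _ => rfl
      map_one := rfl
      map_comp := fun _ _ => rfl }
  let k : X.Hom N.toSymCollection :=
    { toFun := fun {ι} _ x => ⟨φ.toFun ((gen X).toFun x), hgen ι x⟩
      map_map := fun e x => Subtype.ext
        ((congrArg φ.toFun ((gen X).map_map e x)).trans (φ.map_map e _)) }
  -- The generators land in `N`, so they extend to a morphism into `N`; by uniqueness of extensions
  -- from generators, `φ` is this morphism followed by the inclusion. Hence every value of `φ`
  -- carries the membership proof of `N`.
  have h : incl.toFun ((freeLift k).toFun t) = φ.toFun t :=
    freeHom_ext (incl.comp (freeLift k)) φ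
      (fun κ _ x => congrArg Subtype.val (freeLift_gen k x)) t
  rw [← h]
  exact ((freeLift k).toFun t).2

/-! ### Closure properties of interchange -/

section Interchange

variable {O : SymOperad.{u}}

/-- Exchanging rows and columns twice is the identity, so the defining equation can be solved for
its other side. -/
theorem Interchange.symm {ι κ : Type} [Finite ι] [Finite κ] {p : O.obj ι} {q : O.obj κ}
    (h : O.Interchange p q) : O.Interchange q p := by
  refine Eq.trans ?_ (congrArg (O.map (exchange κ ι)) (Eq.symm h))
  exact ((O.map_map_eq _ _ (Equiv.refl _) (fun _ => rfl) _).trans (O.map_refl _)).symm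

/-- By the two unit laws both composites are `q` with its inputs relabelled, and the relabellings
agree pointwise. -/
theorem Interchange.one_left {κ : Type} [Finite κ] (q : O.obj κ) : O.Interchange O.one q := by
  refine (O.one_comp q).trans (Eq.trans ?_ (congrArg (O.map _) (O.comp_one q)).symm)
  exact (O.map_map_eq _ _ _ (fun _ => rfl) _).symm

/-- Relabelling `p` changes the outer index of one composite and the inner indices of the other, so
the two equivariance axioms of `γ` are each used once; the exchange intertwines the two
relabellings. -/
theorem Interchange.map_left {ι ι' κ : Type} [Finite ι] [Finite ι'] [Finite κ] (e : ι ≃ ι')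
    {p : O.obj ι'} {q : O.obj κ} (h : O.Interchange p q) : O.Interchange (O.map e p) q := by
  refine (O.comp_map_left e p (fun _ => q)).trans ?_
  refine Eq.trans ?_ (congrArg (O.map _) (O.comp_map_right (fun _ => e) q (fun _ => p))).symm
  rw [show O.comp p (fun _ => q) = _ from h]
  rw [← O.map_trans, ← O.map_trans]
  exact congrArg (fun g => O.map g (O.comp q fun _ => p)) (Equiv.ext fun _ => rfl)

/-- The operation `r` travels through a two-level composite one level at a time. The stage in
between is `c = γ(p; γ(r; q_i, …, q_i))`: it is reached from `γ(γ(p; q); r, …, r)` by interchanging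
`r` with each `q_i`, and from `γ(r; γ(p; q), …)` by interchanging `r` with `p`. The rest is
bookkeeping of the bijections between index sets. -/
theorem Interchange.comp_left {ι κ : Type} [Finite ι] [Finite κ] {τ : ι → Type}
    [∀ i, Finite (τ i)] {p : O.obj ι} {q : (i : ι) → O.obj (τ i)} {r : O.obj κ}
    (hp : O.Interchange p r) (hq : ∀ i, O.Interchange (q i) r) :
    O.Interchange (O.comp p q) r := by
  -- The exchange of the two outer indices, carrying along the inputs of `q i`, which depend on the
  -- index in `ι` only.
  let F : (Σ x : Σ _ : ι, κ, τ x.1) ≃ Σ y : Σ _ : κ, ι, τ y.2 :=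
    Equiv.sigmaCongrLeft (β := fun y : Σ _ : κ, ι => τ y.2) (exchange ι κ)
  let c := O.comp p (fun i => O.comp r (fun _ : κ => q i))
  -- The lower level: associativity brings each `q i` next to copies of `r`, where `hq` applies.
  have h1 : O.comp (O.comp p q) (fun _ => r) = O.map (Equiv.sigmaAssoc fun i (_ : τ i) => κ)
      (O.map (Equiv.sigmaCongrRight fun i => exchange (τ i) κ) c) :=
    (O.assoc p q (fun _ _ => r)).trans
      (congrArg (O.map _) (O.comp_map_right_eq (fun i => exchange (τ i) κ) p hq))
  -- The upper level: reassociating puts `p` directly above copies of `r`, where `hp` applies, and a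
  -- second reassociation restores `γ(p; q)` below `r`.
  have h2 : O.map (Equiv.sigmaAssoc fun i (_ : κ) => τ i) c =
      O.map F
        (O.map (Equiv.sigmaAssoc fun (_ : κ) i => τ i) (O.comp r (fun _ => O.comp p q))) := by
    refine (O.assoc p (fun _ => r) (fun i _ => q i)).symm.trans ?_
    rw [← O.assoc r (fun _ => p) (fun _ i => q i), show O.comp p (fun _ => r) = _ from hp]
    exact O.comp_map_left (κ := fun y : Σ _ : κ, ι => τ y.2) (exchange ι κ)
      (O.comp r fun _ => p) (fun y => q y.2)
  have h3 : c = O.map (Equiv.sigmaAssoc fun i (_ : κ) => τ i).symm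
      (O.map (Equiv.sigmaAssoc fun i (_ : κ) => τ i) c) :=
    ((O.map_map_eq _ _ (Equiv.refl _) (fun _ => rfl) _).trans (O.map_refl _)).symm
  refine h1.trans ?_
  -- Both sides are now relabellings of `γ(r; γ(p; q), …)`. It remains to see that the chain of
  -- reindexings is the exchange of `Σ i, τ i` with `κ`, which holds on each element by computation.
  rw [h3, h2, ← O.map_trans, ← O.map_trans, ← O.map_trans, ← O.map_trans]
  exact congrArg (fun g : (Σ _ : (Σ i, τ i), κ) ≃ (Σ _ : κ, Σ i, τ i) =>
    O.map g (O.comp r fun _ => O.comp p q)) (Equiv.ext fun _ => rfl)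

theorem Interchange.map_hom {O' : SymOperad.{v}} (φ : O.Hom O') {ι κ : Type} [Finite ι]
    [Finite κ] {p : O.obj ι} {q : O.obj κ} (h : O.Interchange p q) :
    O'.Interchange (φ.toFun p) (φ.toFun q) := by
  refine (φ.map_comp p (fun _ => q)).symm.trans ((congrArg φ.toFun h).trans ?_)
  exact (φ.map_map _ _).trans (congrArg _ (φ.map_comp q (fun _ => p)))

end Interchange

/-- The images of two free operads interchange if the images of the generators do. -/
theorem interchange_of_gen {X : SymCollection.{u}} {Y : SymCollection.{v}} {O : SymOperad.{w}}
    (φ : (free X).Hom O) (ψ : (free Y).Hom O)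
    (h : ∀ (ι κ : Type) [Finite ι] [Finite κ] (x : X.obj ι) (y : Y.obj κ),
      O.Interchange (φ.toFun ((gen X).toFun x)) (ψ.toFun ((gen Y).toFun y)))
    {ι κ : Type} [Finite ι] [Finite κ] (s : (free X).obj ι) (t : (free Y).obj κ) :
    O.Interchange (φ.toFun s) (ψ.toFun t) := by
  -- Two nested inductions: the first on `s` with `t` arbitrary but fixed, the second on `t` with
  -- `s` already reduced to a generator. The second uses the same closure properties, conjugated by
  -- symmetry.
  refine free_induction φ (fun _ _ p => O.Interchange p (ψ.toFun t))
    (fun e _ hp => hp.map_left e) (Interchange.one_left _)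
    (fun _ _ hp hq => hp.comp_left hq) (fun ι _ x => ?_) s
  exact free_induction ψ (fun _ _ q => O.Interchange (φ.toFun ((gen X).toFun x)) q)
    (fun e _ hq => (hq.symm.map_left e).symm) (Interchange.one_left _).symm
    (fun _ _ hp hq => (hp.symm.comp_left fun i => (hq i).symm).symm)
    (fun κ _ y => h ι κ x y) t

/-! ### Presentations and the tensor product -/

theorem presentedMk_surjective {X : SymCollection.{u}} (R : (free X).Relations) {ι : Type}
    [Finite ι] (p : (presented X R).obj ι) :
    ∃ t : (free X).obj ι, (presentedMk X R).toFun t = p :=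
  Quotient.exists_rep (s := (generated R).setoid ι) p

theorem Iso.exists_presentedMk {X : SymCollection.{u}} {R : (free X).Relations}
    {P : SymOperad.{v}} (e : (presented X R).Iso P) {ι : Type} [Finite ι] (p : P.obj ι) :
    ∃ t : (free X).obj ι, e.hom.toFun ((presentedMk X R).toFun t) = p := by
  obtain ⟨t, ht⟩ := presentedMk_surjective R (e.inv.toFun p)
  exact ⟨t, by rw [ht, e.hom_inv]⟩

/-- Two operads given by generators and relations have interchanging images in an operad if and
only if the images of the generators interchange. -/
theorem interchange_iff_gen {X : SymCollection.{u}} {Y : SymCollection.{v}}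
    {R : (free X).Relations} {S : (free Y).Relations} {P : SymOperad.{u}} {Q : SymOperad.{v}}
    (eP : (presented X R).Iso P) (eQ : (presented Y S).Iso Q) {O : SymOperad.{w}}
    (f : P.Hom O) (g : Q.Hom O) :
    (∀ (ι κ : Type) [Finite ι] [Finite κ] (p : P.obj ι) (q : Q.obj κ),
      O.Interchange (f.toFun p) (g.toFun q)) ↔
    ∀ (ι κ : Type) [Finite ι] [Finite κ] (x : X.obj ι) (y : Y.obj κ),
      O.Interchange
        (f.toFun (eP.hom.toFun ((presentedMk X R).toFun ((gen X).toFun x))))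
        (g.toFun (eQ.hom.toFun ((presentedMk Y S).toFun ((gen Y).toFun y)))) := by
  refine ⟨fun h ι κ _ _ x y => h ι κ _ _, fun h ι κ _ _ p q => ?_⟩
  -- Lifting `p` and `q` to the free operads reduces the claim to morphisms out of `T(X)` and
  -- `T(Y)`.
  obtain ⟨s, rfl⟩ := eP.exists_presentedMk p
  obtain ⟨t, rfl⟩ := eQ.exists_presentedMk q
  exact interchange_of_gen (f.comp (eP.hom.comp (presentedMk X R)))
    (g.comp (eQ.hom.comp (presentedMk Y S))) h s t

/-! ### The universal property of the tensor product -/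

theorem tensor_interchange (P : SymOperad.{u}) (Q : SymOperad.{v}) {ι κ : Type} [Finite ι]
    [Finite κ] (p : P.obj ι) (q : Q.obj κ) :
    (tensor P Q).Interchange ((tensorInl P Q).toFun p) ((tensorInr P Q).toFun q) := by
  let π := quotientMk (coprod P Q)
    (generated (InterchangeRel (coprod P Q) (coprodInl P Q).toHom (coprodInr P Q).toHom))
  -- The defining relation is imposed between composites formed in the coproduct; since the
  -- projection is a morphism, it becomes an equation between composites formed in the quotient.
  refine (π.map_comp _ _).symm.trans ((quotientMk_eq (InterchangeRel.mk p q)).trans ?_)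
  exact (π.map_map _ _).trans (congrArg _ (π.map_comp _ _))

/-- Morphisms with interchanging images extend to the tensor product. -/
theorem exists_tensorLift {P : SymOperad.{u}} {Q : SymOperad.{v}} {O : SymOperad.{w}}
    (f : P.Hom O) (g : Q.Hom O)
    (h : ∀ (ι κ : Type) [Finite ι] [Finite κ] (p : P.obj ι) (q : Q.obj κ),
      O.Interchange (f.toFun p) (g.toFun q)) :
    ∃ θ : (tensor P Q).Hom O,
      (∀ (ι : Type) [Finite ι] (p : P.obj ι),
        θ.toFun ((tensorInl P Q).toFun p) = f.toFun p) ∧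
      (∀ (ι : Type) [Finite ι] (q : Q.obj ι),
        θ.toFun ((tensorInr P Q).toFun q) = g.toFun q) := by
  obtain ⟨k, hl, hr⟩ := (coprod_universal P Q O f g).1
  refine ⟨quotientLift _ k ?_, fun ι _ p => hl ι p, fun ι _ q => hr ι q⟩
  rintro _ _ _ _ ⟨p, q⟩
  have hpq := h _ _ p q
  rw [← hl, ← hr] at hpq
  refine (k.map_comp _ _).trans (hpq.trans ?_)
  exact ((k.map_map _ _).trans (congrArg _ (k.map_comp _ _))).symm

/-- Two morphisms from a tensor product which agree on both factors are equal. -/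
theorem tensorHom_ext {P : SymOperad.{u}} {Q : SymOperad.{v}} {O : SymOperad.{w}}
    (φ ψ : (tensor P Q).Hom O)
    (hl : ∀ (ι : Type) [Finite ι] (p : P.obj ι),
      φ.toFun ((tensorInl P Q).toFun p) = ψ.toFun ((tensorInl P Q).toFun p))
    (hr : ∀ (ι : Type) [Finite ι] (q : Q.obj ι),
      φ.toFun ((tensorInr P Q).toFun q) = ψ.toFun ((tensorInr P Q).toFun q))
    {ι : Type} [Finite ι] (t : (tensor P Q).obj ι) : φ.toFun t = ψ.toFun t := by
  induction t using Quotient.inductionOn' with | _ t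
  -- Only the uniqueness half is used. The two morphisms passed as arguments matter for the
  -- existence half alone.
  exact (coprod_universal P Q O (φ.comp (tensorInl P Q)) (φ.comp (tensorInr P Q))).2
    (φ.comp (quotientMk _ _)) (ψ.comp (quotientMk _ _)) hl hr ι t

/-- Morphisms extend to the tensor product if and only if their images interchange. -/
theorem exists_tensorLift_iff {P : SymOperad.{u}} {Q : SymOperad.{v}} {O : SymOperad.{w}}
    (f : P.Hom O) (g : Q.Hom O) :
    (∃ θ : (tensor P Q).Hom O,
      (∀ (ι : Type) [Finite ι] (p : P.obj ι),
        θ.toFun ((tensorInl P Q).toFun p) = f.toFun p) ∧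
      (∀ (ι : Type) [Finite ι] (q : Q.obj ι),
        θ.toFun ((tensorInr P Q).toFun q) = g.toFun q)) ↔
    ∀ (ι κ : Type) [Finite ι] [Finite κ] (p : P.obj ι) (q : Q.obj κ),
      O.Interchange (f.toFun p) (g.toFun q) := by
  refine ⟨?_, exists_tensorLift f g⟩
  -- Interchange holds universally in `P ⊗ Q`, and morphisms preserve it.
  rintro ⟨θ, hl, hr⟩ ι κ _ _ p q
  rw [← hl, ← hr]
  exact (tensor_interchange P Q p q).map_hom θ

/-! ### The presentation of the tensor product -/

theorem freeInl_gen (X : SymCollection.{u}) (Y : SymCollection.{v}) {ι : Type} [Finite ι]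
    (x : X.obj ι) :
    (freeInl X Y).toFun ((gen X).toFun x) = (gen (X.sum Y)).toFun (Sum.inl x) :=
  freeLift_gen _ x

theorem freeInr_gen (X : SymCollection.{u}) (Y : SymCollection.{v}) {ι : Type} [Finite ι]
    (y : Y.obj ι) :
    (freeInr X Y).toFun ((gen Y).toFun y) = (gen (X.sum Y)).toFun (Sum.inr y) :=
  freeLift_gen _ y

/-- The tensor product of two presented operads is presented by the generators and relations of
both factors and the interchange relations between generators. -/
theorem exists_tensor_iso_presented {X : SymCollection.{u}} {Y : SymCollection.{v}}
    (R : (free X).Relations) (S : (free Y).Relations) {P : SymOperad.{u}} {Q : SymOperad.{v}}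
    (eP : (presented X R).Iso P) (eQ : (presented Y S).Iso Q) :
    ∃ e : (tensor P Q).Iso (presented (X.sum Y) (tensorRel R S)),
      (∀ (ι : Type) [Finite ι] (t : (free X).obj ι),
        e.hom.toFun ((tensorInl P Q).toFun (eP.hom.toFun ((presentedMk X R).toFun t))) =
          (presentedMk (X.sum Y) (tensorRel R S)).toFun ((freeInl X Y).toFun t)) ∧
      (∀ (ι : Type) [Finite ι] (t : (free Y).obj ι),
        e.hom.toFun ((tensorInr P Q).toFun (eQ.hom.toFun ((presentedMk Y S).toFun t))) =
          (presentedMk (X.sum Y) (tensorRel R S)).toFun ((freeInr X Y).toFun t)) := by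
  let Z := presented (X.sum Y) (tensorRel R S)
  let π : (free (X.sum Y)).Hom Z := presentedMk (X.sum Y) (tensorRel R S)
  -- The relations `R`, carried into `T(X ⊔ Y)`, are among those defining `Z`, so the map from
  -- `T(X)` descends to the presented operad; the inverse of `eP` then moves it to `P`.
  let jP : (presented X R).Hom Z := quotientLift R (π.comp (freeInl X Y)) (fun ι _ a b h =>
    quotientMk_eq (Or.inl (Or.inl (Relations.image.mk a b h))))
  let iP : P.Hom Z := jP.comp eP.inv
  let jQ : (presented Y S).Hom Z := quotientLift S (π.comp (freeInr X Y)) (fun ι _ a b h =>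
    quotientMk_eq (Or.inl (Or.inr (Relations.image.mk a b h))))
  let iQ : Q.Hom Z := jQ.comp eQ.inv
  have hiP : ∀ (ι : Type) [Finite ι] (t : (free X).obj ι),
      iP.toFun (eP.hom.toFun ((presentedMk X R).toFun t)) = π.toFun ((freeInl X Y).toFun t) :=
    fun ι _ t => congrArg jP.toFun (eP.inv_hom _)
  have hiQ : ∀ (ι : Type) [Finite ι] (t : (free Y).obj ι),
      iQ.toFun (eQ.hom.toFun ((presentedMk Y S).toFun t)) = π.toFun ((freeInr X Y).toFun t) :=
    fun ι _ t => congrArg jQ.toFun (eQ.inv_hom _)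
  -- The essential step: extending to `P ⊗ Q` requires all images to interchange, but it suffices to
  -- check generators, where the equation is a relation from `IC`.
  obtain ⟨θ, hl, hr⟩ := exists_tensorLift iP iQ ((interchange_iff_gen eP eQ iP iQ).2 (by
    intro ι κ _ _ x y
    rw [hiP, hiQ, freeInl_gen, freeInr_gen]
    refine (π.map_comp _ _).symm.trans
      ((quotientMk_eq (Or.inr (InterchangeRel.mk x y))).trans ?_)
    exact (π.map_map _ _).trans (congrArg _ (π.map_comp _ _))))
  let aP : (free X).Hom (tensor P Q) := (tensorInl P Q).comp (eP.hom.comp (presentedMk X R))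
  let aQ : (free Y).Hom (tensor P Q) := (tensorInr P Q).comp (eQ.hom.comp (presentedMk Y S))
  -- The inverse is prescribed on generators by their images in `P ⊗ Q`. Its free extension
  -- restricts to `aP` on `T(X)` and to `aQ` on `T(Y)`.
  let k : (X.sum Y).Hom (tensor P Q).toSymCollection :=
    { toFun := fun a => Sum.elim (aP.toHom.comp (gen X)).toFun (aQ.toHom.comp (gen Y)).toFun a
      map_map := fun e a => by
        rcases a with a | a
        · exact (aP.toHom.comp (gen X)).map_map e a
        · exact (aQ.toHom.comp (gen Y)).map_map e a }
  have hkP : ∀ (ι : Type) [Finite ι] (t : (free X).obj ι),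
      (freeLift k).toFun ((freeInl X Y).toFun t) = aP.toFun t := fun ι _ t =>
    freeHom_ext ((freeLift k).comp (freeInl X Y)) aP (fun κ _ x =>
      (congrArg (freeLift k).toFun (freeInl_gen X Y x)).trans (freeLift_gen k (Sum.inl x))) t
  have hkQ : ∀ (ι : Type) [Finite ι] (t : (free Y).obj ι),
      (freeLift k).toFun ((freeInr X Y).toFun t) = aQ.toFun t := fun ι _ t =>
    freeHom_ext ((freeLift k).comp (freeInr X Y)) aQ (fun κ _ x =>
      (congrArg (freeLift k).toFun (freeInr_gen X Y x)).trans (freeLift_gen k (Sum.inr x))) t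
  let ρ : Z.Hom (tensor P Q) := quotientLift (tensorRel R S) (freeLift k) (by
    -- Relations from `R` and `S` already hold in `P` and `Q`; those from `IC` are instances of the
    -- interchange built into `P ⊗ Q`.
    rintro _ _ _ _ ((⟨a, b, h⟩ | ⟨a, b, h⟩) | ⟨x, y⟩)
    · rw [hkP, hkP]
      exact congrArg (fun z => (tensorInl P Q).toFun (eP.hom.toFun z)) (quotientMk_eq h)
    · rw [hkQ, hkQ]
      exact congrArg (fun z => (tensorInr P Q).toFun (eQ.hom.toFun z)) (quotientMk_eq h)
    · have hx : (freeLift k).toFun ((gen (X.sum Y)).toFun (Sum.inl x)) =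
          aP.toFun ((gen X).toFun x) := freeLift_gen k (Sum.inl x)
      have hy : (freeLift k).toFun ((gen (X.sum Y)).toFun (Sum.inr y)) =
          aQ.toFun ((gen Y).toFun y) := freeLift_gen k (Sum.inr y)
      have hxy : (tensor P Q).Interchange (aP.toFun ((gen X).toFun x))
          (aQ.toFun ((gen Y).toFun y)) := tensor_interchange P Q _ _
      rw [← hx, ← hy] at hxy
      refine ((freeLift k).map_comp _ _).trans (hxy.trans ?_)
      exact (((freeLift k).map_map _ _).trans
        (congrArg _ ((freeLift k).map_comp _ _))).symm)
  have hθP : ∀ (ι : Type) [Finite ι] (t : (free X).obj ι),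
      θ.toFun (aP.toFun t) = π.toFun ((freeInl X Y).toFun t) :=
    fun ι _ t => (hl ι _).trans (hiP ι t)
  have hθQ : ∀ (ι : Type) [Finite ι] (t : (free Y).obj ι),
      θ.toFun (aQ.toFun t) = π.toFun ((freeInr X Y).toFun t) :=
    fun ι _ t => (hr ι _).trans (hiQ ι t)
  let idT : (tensor P Q).Hom (tensor P Q) :=
    { toFun := fun p => p
      map_map := fun _ _ => rfl
      map_one := rfl
      map_comp := fun _ _ => rfl }
  refine ⟨⟨θ, ρ, fun t => ?_, fun z => ?_⟩, hθP, hθQ⟩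
  -- An endomorphism of `P ⊗ Q` is determined on the two factors, and each element of a factor comes
  -- from a free operad, where both maps are known.
  · refine tensorHom_ext (ρ.comp θ) idT (fun ι _ p => ?_) (fun ι _ q => ?_) t
    · obtain ⟨s, rfl⟩ := eP.exists_presentedMk p
      exact (congrArg ρ.toFun (hθP ι s)).trans (hkP ι s)
    · obtain ⟨s, rfl⟩ := eQ.exists_presentedMk q
      exact (congrArg ρ.toFun (hθQ ι s)).trans (hkQ ι s)
  -- After lifting `z` to `T(X ⊔ Y)`, the composite of `ρ` with the projection is `freeLift k` by
  -- definition, so it is enough to compare on the generators of each kind.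
  · obtain ⟨z, rfl⟩ := presentedMk_surjective _ z
    refine freeHom_ext (θ.comp (freeLift k)) π ?_ z
    rintro κ _ (x | y)
    · refine (congrArg θ.toFun (freeLift_gen k (Sum.inl x))).trans ((hθP κ _).trans ?_)
      exact congrArg π.toFun (freeInl_gen X Y x)
    · refine (congrArg θ.toFun (freeLift_gen k (Sum.inr y))).trans ((hθQ κ _).trans ?_)
      exact congrArg π.toFun (freeInr_gen X Y y)

/-- A family indexed by pairs is an array read row by row; the exchange reads it column by column.
After this currying the two sides agree by definition. -/
theorem endOperad_interchange_iff (A : Type u) {ι κ : Type} [Finite ι] [Finite κ]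
    (p : (endOperad A).obj ι) (q : (endOperad A).obj κ) :
    (endOperad A).Interchange p q ↔
      ∀ a : ι → κ → A, p (fun i => q (fun j => a i j)) = q (fun j => p (fun i => a i j)) :=
  ⟨fun h a => congrFun h (fun x => a x.1 x.2), fun h => funext fun a => h (fun i j => a ⟨i, j⟩)⟩

end SymOperad

theorem mainTheorem6
    {X : SymCollection.{u}} {Y : SymCollection.{v}}
    (R : (SymOperad.free X).Relations) (S : (SymOperad.free Y).Relations)
    {P : SymOperad.{u}} {Q : SymOperad.{v}}
    (eP : (SymOperad.presented X R).Iso P) (eQ : (SymOperad.presented Y S).Iso Q) :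
    -- the presentation of the tensor product, compatibly with the given presentations
    (∃ e : (SymOperad.tensor P Q).Iso
          (SymOperad.presented (X.sum Y) (SymOperad.tensorRel R S)),
        (∀ (ι : Type) [Finite ι] (t : (SymOperad.free X).obj ι),
          e.hom.toFun ((SymOperad.tensorInl P Q).toFun
              (eP.hom.toFun ((SymOperad.presentedMk X R).toFun t))) =
            (SymOperad.presentedMk (X.sum Y) (SymOperad.tensorRel R S)).toFun
              ((SymOperad.freeInl X Y).toFun t)) ∧
        (∀ (ι : Type) [Finite ι] (t : (SymOperad.free Y).obj ι),
          e.hom.toFun ((SymOperad.tensorInr P Q).toFun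
              (eQ.hom.toFun ((SymOperad.presentedMk Y S).toFun t))) =
            (SymOperad.presentedMk (X.sum Y) (SymOperad.tensorRel R S)).toFun
              ((SymOperad.freeInr X Y).toFun t))) ∧
    -- operations of `P` and `Q` in any operad interchange iff the generators do
    (∀ (O : SymOperad.{w}) (f : P.Hom O) (g : Q.Hom O),
      (∀ (ι κ : Type) [Finite ι] [Finite κ] (p : P.obj ι) (q : Q.obj κ),
          O.Interchange (f.toFun p) (g.toFun q)) ↔
        ∀ (ι κ : Type) [Finite ι] [Finite κ] (x : X.obj ι) (y : Y.obj κ),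
          O.Interchange
            (f.toFun (eP.hom.toFun
              ((SymOperad.presentedMk X R).toFun ((SymOperad.gen X).toFun x))))
            (g.toFun (eQ.hom.toFun
              ((SymOperad.presentedMk Y S).toFun ((SymOperad.gen Y).toFun y))))) ∧
    -- actions of `P` and `Q` on a set interchange, i.e. come from an action of `P ⊗ Q`,
    -- iff the actions of the generators interchange
    (∀ (A : Type w') (α : P.Hom (SymOperad.endOperad A)) (β : Q.Hom (SymOperad.endOperad A)),
      (∃ θ : (SymOperad.tensor P Q).Hom (SymOperad.endOperad A),
          (∀ (ι : Type) [Finite ι] (p : P.obj ι),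
            θ.toFun ((SymOperad.tensorInl P Q).toFun p) = α.toFun p) ∧
          (∀ (ι : Type) [Finite ι] (q : Q.obj ι),
            θ.toFun ((SymOperad.tensorInr P Q).toFun q) = β.toFun q)) ↔
        ∀ (ι κ : Type) [Finite ι] [Finite κ] (x : X.obj ι) (y : Y.obj κ) (a : ι → κ → A),
          α.toFun (eP.hom.toFun
              ((SymOperad.presentedMk X R).toFun ((SymOperad.gen X).toFun x)))
            (fun i => β.toFun (eQ.hom.toFun
              ((SymOperad.presentedMk Y S).toFun ((SymOperad.gen Y).toFun y)))
              (fun j => a i j)) =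
          β.toFun (eQ.hom.toFun
              ((SymOperad.presentedMk Y S).toFun ((SymOperad.gen Y).toFun y)))
            (fun j => α.toFun (eP.hom.toFun
              ((SymOperad.presentedMk X R).toFun ((SymOperad.gen X).toFun x)))
              (fun i => a i j))) := by
  refine ⟨SymOperad.exists_tensor_iso_presented R S eP eQ,
    fun O f g => SymOperad.interchange_iff_gen eP eQ f g, fun A α β => ?_⟩
  -- An action of `P ⊗ Q` restricting to `α` and `β` amounts to interchange of all operations, hence
  -- to interchange of the generators, which in an endomorphism operad is the stated identity on
  -- arrays.
  rw [SymOperad.exists_tensorLift_iff, SymOperad.interchange_iff_gen eP eQ]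
  simp only [SymOperad.endOperad_interchange_iff]
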